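/- **Theorem (ridge-regularized projection, i.i.d. Gaussian noise).** Let $\delta\in(0,1)$ and let $d_\delta>0$ be a constant depending only on $\delta$ (any such choice is allowed). Then there is a constant $D_\delta>0$, depending only on $\delta$ (and on the chosen value $d_\delta$), such that the following holds for all integers $n,K\ge 1$, every matrix $H\in\mathbb R^{n\times K}$ of full rank $K$, every $\gamma\in\mathbb R$, and every random matrix $E\in\mathbb R^{n\times K}$ whose entries $E_{ij}$ are i.i.d. with law $\mathcal N(0,\gamma^2)$. Put $\hat H=H+E$ and $\alpha=2d_\delta\gamma^2 n$. Let $P_{[H]}$ be the orthogonal projection of $\mathbb R^n$ onto the span $[H]$ of the columns of $H$, and let $$P_{[\hat H]_\alpha}=\hat H\,(\hat H^T\hat H+\alpha I_K)^{-1}\hat H^T .$$ Then, with probability at least $1-\delta$, $$\frac1n\,|||P_{[H]}-P_{[\hat H]_\alpha}|||^2\;\le\;\gamma^2 D_\delta\,\frac{\mathrm{Cond}(H^TH)^3}{\rho_{\min}(H^TH)} .$$ Here $|||\cdot|||$ is the operator norm for the Euclidean norm on $\mathbb R^n$, $\rho(A)$ and $\rho_{\min}(A)$ are the largest and smallest eigenvalues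 of a positive definite matrix $A$, and $\mathrm{Cond}(A)=\rho(A)/\rho_{\min}(A)$. No lower bound on $\rho_{\min}(H^TH)$ in terms of the noise is assumed. -/

import Mathlib

open MeasureTheory ProbabilityTheory
open scoped Matrix

noncomputable section

namespace RidgeProj

/-- The column space `[H]` of a real `n × K` matrix, as a subspace of Euclidean `ℝⁿ`. -/
def colSpan {n K : ℕ} (H : Matrix (Fin n) (Fin K) ℝ) : Submodule ℝ (EuclideanSpace ℝ (Fin n)) :=
  Submodule.span ℝ (Set.range fun j : Fin K => WithLp.toLp 2 fun i : Fin n => H i j)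

/-- The orthogonal projection `P_[H]` of Euclidean `ℝⁿ` onto `[H]`. -/
def proj {n K : ℕ} (H : Matrix (Fin n) (Fin K) ℝ) :
    EuclideanSpace ℝ (Fin n) →L[ℝ] EuclideanSpace ℝ (Fin n) :=
  (colSpan H).starProjection

/-- The ridge-regularized projection `H (Hᵀ H + α I)⁻¹ Hᵀ`, as an operator on Euclidean `ℝⁿ`. -/
def ridgeProj {n K : ℕ} (α : ℝ) (H : Matrix (Fin n) (Fin K) ℝ) :
    EuclideanSpace ℝ (Fin n) →L[ℝ] EuclideanSpace ℝ (Fin n) :=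
  Matrix.toEuclideanCLM (n := Fin n) (𝕜 := ℝ)
    (H * (Hᵀ * H + α • (1 : Matrix (Fin K) (Fin K) ℝ))⁻¹ * Hᵀ)

/-- The largest eigenvalue of a (symmetric, nonempty) matrix. -/
def rhoMax {K : ℕ} (A : Matrix (Fin K) (Fin K) ℝ) : ℝ := sSup (spectrum ℝ A)

/-- The smallest eigenvalue of a (symmetric, nonempty) matrix. -/
def rhoMin {K : ℕ} (A : Matrix (Fin K) (Fin K) ℝ) : ℝ := sInf (spectrum ℝ A)

/-- The condition number of a positive definite matrix. -/
def cond {K : ℕ} (A : Matrix (Fin K) (Fin K) ℝ) : ℝ := rhoMax A / rhoMin A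

/-- The entries of the random matrix `E` are i.i.d. with law `𝒩(0, γ²)`. -/
structure IsIIDGaussian {Ω : Type*} [MeasurableSpace Ω] {n K : ℕ} (γ : ℝ)
    (E : Ω → Matrix (Fin n) (Fin K) ℝ) (P : Measure Ω) : Prop where
  indep : iIndepFun (fun (p : Fin n × Fin K) (ω : Ω) => E ω p.1 p.2) P
  law : ∀ i j, HasLaw (fun ω => E ω i j) (gaussianReal 0 ⟨γ ^ 2, sq_nonneg γ⟩) P

end RidgeProj

end

/-! Put s = nγ²/ρ_min(HᵀH). A union bound over nets gives ‖E‖² ≤ C n γ² with probability at least 1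
- δ (`one_sub_le_measureReal_opNorm_sq_le`); the rest is deterministic. If 4Cs ≤ 1, the noise is at
most half the least singular value of H, and the ridge normal equations give an error O(√s) + O(s)
(`norm_starProjection_sub_le`). Otherwise both operators are contractions, and the trivial bound 2
is already O(√s). Hence no lower bound on the signal is needed, and Cond³ enters only through Cond ≥
1. -/

namespace RidgeProj

/-! ### Nets and operator norms -/

open Module in
/-- A finite `1`-net of the ball of radius `2`, of cardinality at most `5 ^ dim`. -/
theorem exists_finset_net (V : Type*) [NormedAddCommGroup V] [NormedSpace ℝ V]
    [FiniteDimensional ℝ V] :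
    ∃ s : Finset V, s.card ≤ 5 ^ finrank ℝ V ∧ (∀ c ∈ s, ‖c‖ ≤ 2) ∧
      ∀ x : V, ‖x‖ ≤ 2 → ∃ c ∈ s, ‖x - c‖ ≤ 1 := by
  classical
  by_contra! hcon
  -- Without a net, 1-separated sets could be enlarged forever, against the packing bound `5 ^ dim`.
  have key : ∀ m : ℕ, ∃ s : Finset V, s.card = m ∧ (∀ c ∈ s, ‖c‖ ≤ 2) ∧
      ∀ c ∈ s, ∀ d ∈ s, c ≠ d → 1 ≤ ‖c - d‖ := by
    intro m
    induction m with
    | zero => exact ⟨∅, by simp⟩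
    | succ m ih =>
      obtain ⟨s, hs, h2, hsep⟩ := ih
      obtain ⟨x, hx2, hx⟩ := hcon s (Besicovitch.card_le_of_separated s h2 hsep) h2
      have hxs : x ∉ s := fun h => by simpa using (hx x h).trans' zero_lt_one
      refine ⟨insert x s, by rw [Finset.card_insert_of_notMem hxs, hs], ?_, ?_⟩
      · intro c hc
        rcases Finset.mem_insert.1 hc with rfl | hc
        exacts [hx2, h2 c hc]
      · intro c hc d hd hcd
        rcases Finset.mem_insert.1 hc with rfl | hc' <;>
          rcases Finset.mem_insert.1 hd with rfl | hd'
        · exact absurd rfl hcd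
        · exact (hx d hd').le
        · rw [norm_sub_rev]; exact (hx c hc').le
        · exact hsep c hc' d hd' hcd
  obtain ⟨s, hs, h2, hsep⟩ := key (5 ^ finrank ℝ V + 1)
  have := Besicovitch.card_le_of_separated s h2 hsep
  omega

/-- A net point c within 1 of 2y/‖y‖ gives 2‖y‖ ≤ ⟨c, y⟩ + ‖y‖; radius 2 with mesh 1 loses no
constant. -/
theorem norm_le_of_forall_net_inner_le {V : Type*} [NormedAddCommGroup V]
    [InnerProductSpace ℝ V] {s : Finset V}
    (hs : ∀ x : V, ‖x‖ ≤ 2 → ∃ c ∈ s, ‖x - c‖ ≤ 1) {y : V} {t : ℝ} (ht : 0 ≤ t)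
    (h : ∀ u ∈ s, inner ℝ u y ≤ t) : ‖y‖ ≤ t := by
  rcases eq_or_ne y 0 with rfl | hy
  · simpa using ht
  have hy' : 0 < ‖y‖ := norm_pos_iff.2 hy
  obtain ⟨c, hc, hxc⟩ := hs ((2 / ‖y‖) • y) (by
    rw [norm_smul, Real.norm_of_nonneg (by positivity)]; field_simp; rfl)
  have h1 : inner ℝ ((2 / ‖y‖) • y - c) y ≤ 1 * ‖y‖ :=
    (real_inner_le_norm _ _).trans (by gcongr)
  have h2 : inner ℝ ((2 / ‖y‖) • y) y = 2 * ‖y‖ := by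
    rw [real_inner_smul_left, real_inner_self_eq_norm_sq]; field_simp
  rw [inner_sub_left, h2] at h1
  linarith [h c hc]

theorem opNorm_le_of_forall_net_norm_le {V W : Type*} [NormedAddCommGroup V] [NormedSpace ℝ V]
    [NormedAddCommGroup W] [NormedSpace ℝ W] {s : Finset V}
    (hs : ∀ x : V, ‖x‖ ≤ 2 → ∃ c ∈ s, ‖x - c‖ ≤ 1) (M : V →L[ℝ] W) {t : ℝ} (ht : 0 ≤ t)
    (h : ∀ v ∈ s, ‖M v‖ ≤ t) : ‖M‖ ≤ t := by
  have key : ‖M‖ ≤ (t + ‖M‖) / 2 := by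
    refine ContinuousLinearMap.opNorm_le_of_unit_norm (by positivity) fun x hx => ?_
    obtain ⟨c, hc, hxc⟩ := hs ((2 : ℝ) • x) (by rw [norm_smul, hx]; norm_num)
    have h1 : ‖M ((2 : ℝ) • x - c)‖ ≤ ‖M‖ * 1 := (M.le_opNorm _).trans (by gcongr)
    have h2 : ‖M ((2 : ℝ) • x)‖ ≤ ‖M c‖ + ‖M ((2 : ℝ) • x - c)‖ := by
      rw [map_sub]
      exact norm_le_norm_add_norm_sub' _ _
    rw [map_smul, norm_smul, Real.norm_of_nonneg zero_le_two] at h2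
    linarith [h c hc]
  linarith

theorem inner_toEuclideanLin {n K : ℕ} (M : Matrix (Fin n) (Fin K) ℝ)
    (u : EuclideanSpace ℝ (Fin n)) (v : EuclideanSpace ℝ (Fin K)) :
    inner ℝ u (M.toEuclideanLin v) = ∑ p : Fin n × Fin K, (u p.1 * v p.2) * M p.1 p.2 := by
  rw [Fintype.sum_prod_type, PiLp.inner_apply]
  refine Finset.sum_congr rfl fun i _ => ?_
  simp only [Matrix.toLpLin_apply, Matrix.mulVec, dotProduct, RCLike.inner_apply,
    conj_trivial, Finset.sum_mul]
  exact Finset.sum_congr rfl fun j _ => by ring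

theorem sum_prod_sq {n K : ℕ} (u : EuclideanSpace ℝ (Fin n)) (v : EuclideanSpace ℝ (Fin K)) :
    ∑ p : Fin n × Fin K, (u p.1 * v p.2) ^ 2 = ‖u‖ ^ 2 * ‖v‖ ^ 2 := by
  simp only [EuclideanSpace.real_norm_sq_eq, Fintype.sum_prod_type, mul_pow,
    Finset.sum_mul_sum]

/-! ### Gaussian tail bounds -/

variable {Ω : Type*} [MeasurableSpace Ω] {P : Measure Ω}

theorem hasSubgaussianMGF_of_hasLaw_gaussianReal {X : Ω → ℝ} {v : NNReal}
    (h : HasLaw X (gaussianReal 0 v) P) : HasSubgaussianMGF X v P where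
  integrable_exp_mul t := by
    have := integrable_exp_mul_gaussianReal (μ := 0) (v := v) t
    rw [← h.map_eq] at this
    exact (integrable_map_measure (by fun_prop) h.aemeasurable).1 this
  mgf_le t := by
    rw [mgf_gaussianReal h.map_eq]
    simp

/-- ⟨u, Ev⟩ is sub-Gaussian with variance proxy ‖u‖²‖v‖²γ² ≤ 16γ², whence 32 = 2 · 16. -/
theorem measureReal_le_inner_toEuclideanLin {n K : ℕ} {γ : ℝ} {E : Ω → Matrix (Fin n) (Fin K) ℝ}
    (hγ : γ ≠ 0) (hE : IsIIDGaussian γ E P) {u : EuclideanSpace ℝ (Fin n)}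
    {v : EuclideanSpace ℝ (Fin K)} (hu : ‖u‖ ≤ 2) (hv : ‖v‖ ≤ 2) {t : ℝ} (ht : 0 < t) :
    P.real {ω | t ≤ inner ℝ u ((E ω).toEuclideanLin v)} ≤
      Real.exp (-t ^ 2 / (32 * γ ^ 2)) := by
  have hP : IsProbabilityMeasure P := hE.indep.isProbabilityMeasure
  have hind : iIndepFun (fun (p : Fin n × Fin K) ω => (u p.1 * v p.2) * E ω p.1 p.2) P :=
    hE.indep.comp (fun p x => (u p.1 * v p.2) * x) fun p => by fun_prop
  let c : Fin n × Fin K → NNReal := fun p => ⟨(u p.1 * v p.2) ^ 2, sq_nonneg _⟩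
  let g : NNReal := ⟨γ ^ 2, sq_nonneg γ⟩
  have hsub := HasSubgaussianMGF.sum_of_iIndepFun hind (c := fun p => c p * g)
    (s := Finset.univ) fun p _ =>
    (hasSubgaussianMGF_of_hasLaw_gaussianReal (hE.law p.1 p.2)).const_mul (u p.1 * v p.2)
  have hle := hsub.measure_ge_le ht.le
  simp only [← inner_toEuclideanLin] at hle
  have hc : ((∑ p, c p * g : NNReal) : ℝ) = ‖u‖ ^ 2 * ‖v‖ ^ 2 * γ ^ 2 := by
    rw [← sum_prod_sq, Finset.sum_mul]
    push_cast
    rfl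
  rw [hc] at hle
  have hγ' : 0 < γ ^ 2 := by positivity
  -- At zero variance the exponent is a division by zero, but the event is empty since t > 0.
  by_cases h0 : ‖u‖ ^ 2 * ‖v‖ ^ 2 = 0
  · have : ∀ ω, ¬ t ≤ inner ℝ u ((E ω).toEuclideanLin v) := by
      intro ω
      have : u = 0 ∨ v = 0 := by simpa using h0
      rcases this with rfl | rfl <;> simpa using ht
    simp only [this, Set.ofPred_false, measureReal_empty]
    positivity
  · have hpos : 0 < ‖u‖ ^ 2 * ‖v‖ ^ 2 := lt_of_le_of_ne (by positivity) (Ne.symm h0)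
    refine hle.trans (Real.exp_le_exp.2 ?_)
    rw [neg_div, neg_div, neg_le_neg_iff]
    refine div_le_div_of_nonneg_left (by positivity) (by positivity) ?_
    have : ‖u‖ ^ 2 * ‖v‖ ^ 2 ≤ 2 ^ 2 * 2 ^ 2 := by gcongr
    nlinarith

/-- The `δ`-quantile constant for the squared operator norm of a Gaussian matrix. -/
noncomputable def noiseConst (δ : ℝ) : ℝ := 32 * (2 * Real.log 5 + Real.log δ⁻¹)

theorem noiseConst_pos {δ : ℝ} (h0 : 0 < δ) (h1 : δ < 1) : 0 < noiseConst δ := by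
  have := Real.log_pos (show (1 : ℝ) < 5 by norm_num)
  have := Real.log_pos ((one_lt_inv₀ h0).2 h1)
  unfold noiseConst
  positivity

/-- The operator norm of an `n × K` Gaussian matrix with `K ≤ n` is `O(γ √n)` with probability
at least `1 - δ`. -/
theorem one_sub_le_measureReal_opNorm_sq_le {n K : ℕ} {γ δ : ℝ} (h0 : 0 < δ) (h1 : δ < 1)
    (hn : 0 < n) (hKn : K ≤ n) {E : Ω → Matrix (Fin n) (Fin K) ℝ} (hE : IsIIDGaussian γ E P) :
    1 - δ ≤ P.real {ω | ‖(E ω).toEuclideanLin.toContinuousLinearMap‖ ^ 2 ≤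
      noiseConst δ * (n * γ ^ 2)} := by
  have hP : IsProbabilityMeasure P := hE.indep.isProbabilityMeasure
  have hC := noiseConst_pos h0 h1
  rcases eq_or_ne γ 0 with rfl | hγ
  · have hae : ∀ᵐ ω ∂P, E ω = 0 := by
      have : ∀ i j, ∀ᵐ ω ∂P, E ω i j = 0 := fun i j => by
        have h := hE.law i j
        have hz : gaussianReal 0 ⟨(0 : ℝ) ^ 2, sq_nonneg 0⟩ = Measure.dirac 0 := by
          rw [← gaussianReal_zero_var]
          congr 1
          ext
          exact zero_pow two_ne_zero
        exact HasLaw.ae_eq_of_dirac ⟨h.aemeasurable, h.map_eq.trans hz⟩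
      filter_upwards [ae_all_iff.2 fun i => ae_all_iff.2 (this i)] with ω hω
      ext i j
      exact hω i j
    have : P.real {ω | ‖(E ω).toEuclideanLin.toContinuousLinearMap‖ ^ 2 ≤
        noiseConst δ * (n * (0 : ℝ) ^ 2)} = P.real Set.univ := by
      refine measureReal_congr ?_
      filter_upwards [hae] with ω hω
      refine propext ⟨fun _ => trivial, fun _ => ?_⟩
      change ‖(E ω).toEuclideanLin.toContinuousLinearMap‖ ^ 2 ≤ _
      simp [hω]
    rw [this, probReal_univ]
    linarith
  have hγ' : 0 < γ ^ 2 := by positivity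
  have hn' : (1 : ℝ) ≤ n := by exact_mod_cast hn
  obtain ⟨S, hScard, hS2, hSnet⟩ := exists_finset_net (EuclideanSpace ℝ (Fin n))
  obtain ⟨T, hTcard, hT2, hTnet⟩ := exists_finset_net (EuclideanSpace ℝ (Fin K))
  rw [finrank_euclideanSpace_fin] at hScard hTcard
  set t : ℝ := √(noiseConst δ * (n * γ ^ 2)) with ht_def
  have ht : 0 < t := Real.sqrt_pos.2 (by positivity)
  have ht2 : t ^ 2 = noiseConst δ * (n * γ ^ 2) := Real.sq_sqrt (by positivity)
  -- Covering the whole space, rather than taking complements, avoids measurability of the events.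
  have hcover : Set.univ ⊆ {ω | ‖(E ω).toEuclideanLin.toContinuousLinearMap‖ ^ 2 ≤
      noiseConst δ * (n * γ ^ 2)} ∪
      ⋃ p ∈ S ×ˢ T, {ω | t ≤ inner ℝ p.1 ((E ω).toEuclideanLin p.2)} := by
    intro ω _
    by_contra hω
    simp only [Set.mem_union, Set.mem_iUnion, Set.mem_ofPred_eq, not_or, not_exists, not_le] at hω
    refine hω.1.not_ge ?_
    rw [← ht2]
    refine pow_le_pow_left₀ (norm_nonneg _) ?_ 2
    refine opNorm_le_of_forall_net_norm_le hTnet _ ht.le fun v hv => ?_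
    refine norm_le_of_forall_net_inner_le hSnet ht.le fun u hu => ?_
    exact (hω.2 (u, v) (Finset.mk_mem_product hu hv)).le
  have hbad : P.real (⋃ p ∈ S ×ˢ T, {ω | t ≤ inner ℝ p.1 ((E ω).toEuclideanLin p.2)}) ≤ δ := by
    calc _ ≤ ∑ p ∈ S ×ˢ T, P.real {ω | t ≤ inner ℝ p.1 ((E ω).toEuclideanLin p.2)} :=
          measureReal_biUnion_finset_le _ _
      _ ≤ ∑ p ∈ S ×ˢ T, Real.exp (-t ^ 2 / (32 * γ ^ 2)) := by
          refine Finset.sum_le_sum fun p hp => ?_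
          rw [Finset.mem_product] at hp
          exact measureReal_le_inner_toEuclideanLin hγ hE (hS2 _ hp.1) (hT2 _ hp.2) ht
      _ = (S.card * T.card : ℝ) * Real.exp (-t ^ 2 / (32 * γ ^ 2)) := by
          rw [Finset.sum_const, nsmul_eq_mul, Finset.card_product, Nat.cast_mul]
      _ ≤ (5 ^ n * 5 ^ n) * Real.exp (-(2 * n * Real.log 5 + Real.log δ⁻¹)) := by
          gcongr
          · exact_mod_cast hScard
          · exact_mod_cast hTcard.trans (Nat.pow_le_pow_right (by norm_num) hKn)
          · rw [ht2, noiseConst, neg_div, neg_le_neg_iff]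
            rw [le_div_iff₀ (by positivity)]
            have := (Real.log_pos ((one_lt_inv₀ h0).2 h1)).le
            have h3 : Real.log δ⁻¹ ≤ n * Real.log δ⁻¹ := le_mul_of_one_le_left this hn'
            have := mul_le_mul_of_nonneg_right h3 hγ'.le
            linarith
      _ = δ := by
          rw [neg_add, Real.exp_add, Real.log_inv, neg_neg, Real.exp_log h0, Real.exp_neg,
            mul_comm 2 (n : ℝ), mul_assoc (n : ℝ), Real.exp_nat_mul, two_mul, Real.exp_add,
            Real.exp_log (by norm_num), mul_pow]
          field_simp
  have h3 := (measureReal_mono (μ := P) hcover).trans (measureReal_union_le _ _)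
  rw [probReal_univ] at h3
  linarith

end RidgeProj

/-! ### Deterministic perturbation bounds -/

namespace RidgeProj

/-- `hQ` is the normal equation of ridge regression. Split y = Tz + w with w ⟂ range T. Testing with
z - x₁ bounds the error on Tz; on w only N contributes, as ⟨w, Tv⟩ = 0. Both use ‖(T + N)x‖ ≥
(ρ/2)‖x‖. -/
theorem norm_starProjection_sub_le {V W : Type*}
    [NormedAddCommGroup V] [InnerProductSpace ℝ V] [NormedAddCommGroup W] [InnerProductSpace ℝ W]
    {T N : V →ₗ[ℝ] W} {U : Submodule ℝ W} [U.HasOrthogonalProjection] (hU : U = T.range)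
    {Q : W →L[ℝ] W} {α ρ ε : ℝ} (hα : 0 ≤ α) (hρ : 0 < ρ)
    (hT : ∀ x, ρ * ‖x‖ ≤ ‖T x‖) (hN : ∀ x, ‖N x‖ ≤ ε * ‖x‖) (hε0 : 0 ≤ ε) (hε : ε ≤ ρ / 2)
    (hQ : ∀ y, ∃ x, Q y = (T + N) x ∧
      ∀ v, inner ℝ ((T + N) x) ((T + N) v) + α * inner ℝ x v = inner ℝ y ((T + N) v)) :
    ‖U.starProjection - Q‖ ≤ 4 * ε / ρ + 2 * α / ρ ^ 2 := by
  have hTN : ∀ x, ‖x‖ ≤ 2 / ρ * ‖(T + N) x‖ := fun x => by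
    have h1 : ‖T x‖ ≤ ‖(T + N) x‖ + ‖N x‖ := by
      simpa using norm_sub_le ((T + N) x) (N x)
    have h2 : ε * ‖x‖ ≤ ρ / 2 * ‖x‖ := by gcongr
    rw [div_mul_eq_mul_div, le_div_iff₀ hρ]
    linarith [hT x, hN x]
  have cancel : ∀ a b : ℝ, 0 ≤ a → 0 ≤ b → a ^ 2 ≤ a * b → a ≤ b := fun a b ha hb h => by
    by_contra! hab
    nlinarith
  refine ContinuousLinearMap.opNorm_le_bound _ (by positivity) fun y => ?_
  obtain ⟨z, hz⟩ : ∃ z, T z = U.starProjection y := by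
    have : U.starProjection y ∈ T.range := hU ▸ U.starProjection_apply_mem y
    exact this
  set w := y - T z with hw
  have hwT : ∀ v, inner ℝ w (T v) = 0 := fun v => by
    rw [hw, hz]
    exact U.starProjection_inner_eq_zero y (T v) (hU ▸ LinearMap.mem_range_self T v)
  have hTz : ‖T z‖ ≤ ‖y‖ := hz ▸ U.norm_starProjection_apply_le y
  have hwy : ‖w‖ ≤ ‖y‖ := by
    have h0 : ‖y‖ * ‖y‖ = ‖w‖ * ‖w‖ + ‖T z‖ * ‖T z‖ := by
      rw [← norm_add_sq_eq_norm_sq_add_norm_sq_of_inner_eq_zero _ _ (hwT z)]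
      simp [hw]
    nlinarith [norm_nonneg w, norm_nonneg y, norm_nonneg (T z)]
  have hzy : ‖z‖ ≤ ‖y‖ / ρ := by
    rw [le_div_iff₀ hρ]
    linarith [hT z]
  obtain ⟨x₁, hx₁, h₁⟩ := hQ (T z)
  obtain ⟨x₂, hx₂, h₂⟩ := hQ w
  have e1 : ‖(T + N) (z - x₁)‖ ≤ (ε + 2 * α / ρ) * ‖z‖ := by
    obtain ⟨u, hu⟩ : ∃ u, z - x₁ = u := ⟨_, rfl⟩
    rw [hu]
    refine cancel _ _ (norm_nonneg _) (by positivity) ?_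
    have h3 := h₁ u
    have hx : x₁ = z - u := by rw [← hu]; abel
    have hTz' : T z = (T + N) z - N z := by simp
    rw [hx, map_sub, hTz', inner_sub_left, inner_sub_left, inner_sub_left,
      real_inner_self_eq_norm_sq, real_inner_self_eq_norm_sq] at h3
    have h4 : inner ℝ (N z) ((T + N) u) ≤ ε * ‖z‖ * ‖(T + N) u‖ :=
      (real_inner_le_norm _ _).trans (by gcongr; exact hN z)
    have h5 : inner ℝ z u ≤ ‖z‖ * (2 / ρ * ‖(T + N) u‖) :=
      (real_inner_le_norm _ _).trans (by gcongr; exact hTN u)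
    have h6 : α * inner ℝ z u ≤ α * (‖z‖ * (2 / ρ * ‖(T + N) u‖)) := by gcongr
    have h7 : 0 ≤ α * ‖u‖ ^ 2 := by positivity
    calc ‖(T + N) u‖ ^ 2 ≤ ε * ‖z‖ * ‖(T + N) u‖ + α * (‖z‖ * (2 / ρ * ‖(T + N) u‖)) := by
          linarith
      _ = _ := by ring
  have e2 : ‖(T + N) x₂‖ ≤ ε * (2 / ρ) * ‖w‖ := by
    refine cancel _ _ (norm_nonneg _) (by positivity) ?_
    have h3 := h₂ x₂
    rw [LinearMap.add_apply, inner_add_right w, hwT, zero_add, ← LinearMap.add_apply,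
      real_inner_self_eq_norm_sq, real_inner_self_eq_norm_sq] at h3
    have h4 : inner ℝ w (N x₂) ≤ ‖w‖ * (ε * (2 / ρ * ‖(T + N) x₂‖)) :=
      (real_inner_le_norm _ _).trans (by
        gcongr
        exact (hN x₂).trans (by gcongr; exact hTN x₂))
    have h7 : 0 ≤ α * ‖x₂‖ ^ 2 := by positivity
    calc ‖(T + N) x₂‖ ^ 2 ≤ ‖w‖ * (ε * (2 / ρ * ‖(T + N) x₂‖)) := by linarith
      _ = _ := by ring
  have hdec : (U.starProjection - Q) y = (T + N) (z - x₁) - N z - (T + N) x₂ := by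
    have hy : y = T z + w := by simp [hw]
    have hQy : Q y = (T + N) x₁ + (T + N) x₂ := by
      rw [← hx₁, ← hx₂, ← map_add, ← hy]
    rw [_root_.sub_apply, ← hz, hQy, map_sub, LinearMap.add_apply T N z]
    abel
  rw [hdec]
  calc _ ≤ ‖(T + N) (z - x₁)‖ + ‖N z‖ + ‖(T + N) x₂‖ :=
        (norm_sub_le _ _).trans (by gcongr; exact norm_sub_le _ _)
    _ ≤ (ε + 2 * α / ρ) * ‖z‖ + ε * ‖z‖ + ε * (2 / ρ) * ‖w‖ := by
        gcongr
        exact hN z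
    _ ≤ (ε + 2 * α / ρ) * (‖y‖ / ρ) + ε * (‖y‖ / ρ) + ε * (2 / ρ) * ‖y‖ := by gcongr
    _ = _ := by field_simp; ring

/-- Testing with v = x gives ‖Tx‖² ≤ ⟨y, Tx⟩, so Q is a contraction, like the projection. -/
theorem norm_starProjection_sub_le_two {V W : Type*}
    [NormedAddCommGroup V] [InnerProductSpace ℝ V] [NormedAddCommGroup W] [InnerProductSpace ℝ W]
    {T : V →ₗ[ℝ] W} (U : Submodule ℝ W) [U.HasOrthogonalProjection]
    {Q : W →L[ℝ] W} {α : ℝ} (hα : 0 ≤ α)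
    (hQ : ∀ y, ∃ x, Q y = T x ∧
      ∀ v, inner ℝ (T x) (T v) + α * inner ℝ x v = inner ℝ y (T v)) :
    ‖U.starProjection - Q‖ ≤ 2 := by
  have h1 : ‖Q‖ ≤ 1 := by
    refine ContinuousLinearMap.opNorm_le_bound _ zero_le_one fun y => ?_
    obtain ⟨x, hx, h⟩ := hQ y
    have h3 := h x
    rw [real_inner_self_eq_norm_sq, real_inner_self_eq_norm_sq] at h3
    have h4 := real_inner_le_norm y (T x)
    have h7 : 0 ≤ α * ‖x‖ ^ 2 := by positivity
    rw [hx, one_mul]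
    by_contra! hlt
    nlinarith [norm_nonneg y]
  linarith [norm_sub_le U.starProjection Q, U.starProjection_norm_le]

/-! ### Ridge matrices and Gram spectra -/

theorem inner_toEuclideanLin_toEuclideanLin {n K : ℕ} (M : Matrix (Fin n) (Fin K) ℝ)
    (x v : EuclideanSpace ℝ (Fin K)) :
    inner ℝ (M.toEuclideanLin x) (M.toEuclideanLin v) =
      (Mᵀ * M) *ᵥ x.ofLp ⬝ᵥ v.ofLp := by
  rw [EuclideanSpace.inner_eq_star_dotProduct, star_trivial, Matrix.toLpLin_apply,
    Matrix.toLpLin_apply, ← Matrix.mulVec_mulVec, Matrix.mulVec_transpose,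
    ← Matrix.dotProduct_mulVec, dotProduct_comm]

theorem ridgeProj_spec {n K : ℕ} (M : Matrix (Fin n) (Fin K) ℝ) {α : ℝ}
    (hdet : IsUnit (Mᵀ * M + α • (1 : Matrix (Fin K) (Fin K) ℝ)).det)
    (y : EuclideanSpace ℝ (Fin n)) :
    ∃ x, ridgeProj α M y = M.toEuclideanLin x ∧ ∀ v,
      inner ℝ (M.toEuclideanLin x) (M.toEuclideanLin v) + α * inner ℝ x v =
        inner ℝ y (M.toEuclideanLin v) := by
  refine ⟨WithLp.toLp 2 ((Mᵀ * M + α • (1 : Matrix (Fin K) (Fin K) ℝ))⁻¹ *ᵥ (Mᵀ *ᵥ y.ofLp)),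
    ?_, fun v => ?_⟩
  · ext1
    simp [ridgeProj, Matrix.toLpLin_apply, Matrix.mulVec_mulVec, Matrix.mul_assoc]
  · set x := (Mᵀ * M + α • (1 : Matrix (Fin K) (Fin K) ℝ))⁻¹ *ᵥ (Mᵀ *ᵥ y.ofLp) with hx
    have h : (Mᵀ * M) *ᵥ x + α • x = Mᵀ *ᵥ y.ofLp := by
      have : (Mᵀ * M + α • (1 : Matrix (Fin K) (Fin K) ℝ)) *ᵥ x = Mᵀ *ᵥ y.ofLp := by
        rw [hx, Matrix.mulVec_mulVec, Matrix.mul_nonsing_inv _ hdet, Matrix.one_mulVec]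
      rwa [Matrix.add_mulVec, Matrix.smul_mulVec, Matrix.one_mulVec] at this
    rw [inner_toEuclideanLin_toEuclideanLin, EuclideanSpace.inner_eq_star_dotProduct,
      EuclideanSpace.inner_eq_star_dotProduct, star_trivial, star_trivial, dotProduct_comm v.ofLp,
      ← smul_eq_mul, ← smul_dotProduct, ← add_dotProduct, h, Matrix.toLpLin_apply,
      Matrix.mulVec_transpose, ← Matrix.dotProduct_mulVec, dotProduct_comm]

/-- A kernel vector x satisfies ‖Mx‖² + α‖x‖² = 0. The injective alternative covers α = 0. -/
theorem isUnit_det_gram_add_smul {n K : ℕ} (M : Matrix (Fin n) (Fin K) ℝ) {α : ℝ} (hα : 0 ≤ α)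
    (h : 0 < α ∨ Function.Injective M.toEuclideanLin) :
    IsUnit (Mᵀ * M + α • (1 : Matrix (Fin K) (Fin K) ℝ)).det := by
  rw [isUnit_iff_ne_zero]
  intro h0
  obtain ⟨x, hx0, hx⟩ := Matrix.exists_mulVec_eq_zero_iff.2 h0
  rw [Matrix.add_mulVec, Matrix.smul_mulVec, Matrix.one_mulVec] at hx
  have h1 := inner_toEuclideanLin_toEuclideanLin M (WithLp.toLp 2 x) (WithLp.toLp 2 x)
  have h2 : inner ℝ (WithLp.toLp 2 x) (WithLp.toLp 2 x) = x ⬝ᵥ x := by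
    rw [EuclideanSpace.inner_eq_star_dotProduct, star_trivial]
  have h3 := congrArg (· ⬝ᵥ x) hx
  simp only [add_dotProduct, smul_dotProduct, zero_dotProduct, smul_eq_mul] at h3
  rw [real_inner_self_eq_norm_sq] at h1 h2
  rw [← h2, ← h1] at h3
  have hne : (WithLp.toLp 2 x : EuclideanSpace ℝ (Fin K)) ≠ 0 := by simpa using hx0
  have hpos : 0 < ‖(WithLp.toLp 2 x : EuclideanSpace ℝ (Fin K))‖ := norm_pos_iff.2 hne
  rcases h with h | h
  · have : 0 < α * ‖(WithLp.toLp 2 x : EuclideanSpace ℝ (Fin K))‖ ^ 2 := by positivity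
    nlinarith [sq_nonneg ‖M.toEuclideanLin (WithLp.toLp 2 x)‖]
  · have h4 : 0 < ‖M.toEuclideanLin (WithLp.toLp 2 x)‖ :=
      norm_pos_iff.2 fun h5 => hne (h (h5.trans (map_zero _).symm))
    have : 0 ≤ α * ‖(WithLp.toLp 2 x : EuclideanSpace ℝ (Fin K))‖ ^ 2 := by positivity
    nlinarith

theorem colSpan_eq_range {n K : ℕ} (H : Matrix (Fin n) (Fin K) ℝ) :
    colSpan H = H.toEuclideanLin.range := by
  apply le_antisymm
  · rw [colSpan, Submodule.span_le]
    rintro _ ⟨j, rfl⟩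
    refine ⟨WithLp.toLp 2 (Pi.single j 1), ?_⟩
    rw [Matrix.toLpLin_apply, Matrix.mulVec_single_one]
    rfl
  · rintro _ ⟨x, rfl⟩
    have : H.toEuclideanLin x = ∑ j, x j • (WithLp.toLp 2 fun i : Fin n => H i j) := by
      ext i
      simp [Matrix.toLpLin_apply, Matrix.mulVec, dotProduct, mul_comm]
    rw [this]
    exact Submodule.sum_mem _ fun j _ => Submodule.smul_mem _ _ (Submodule.subset_span ⟨j, rfl⟩)

theorem posDef_transpose_mul_self {n K : ℕ} {H : Matrix (Fin n) (Fin K) ℝ} (hH : H.rank = K) :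
    (Hᵀ * H).PosDef := by
  rw [← Matrix.conjTranspose_eq_transpose_of_trivial]
  refine Matrix.PosDef.conjTranspose_mul_self _ ?_
  rw [Matrix.mulVec_injective_iff, linearIndependent_iff_card_eq_finrank_span, Fintype.card_fin,
    Set.finrank, ← Matrix.rank_eq_finrank_span_cols, hH]

theorem rhoMin_pos {K : ℕ} (hK : 0 < K) {A : Matrix (Fin K) (Fin K) ℝ} (hA : A.PosDef) :
    0 < rhoMin A := by
  have : Nonempty (Fin K) := ⟨⟨0, hK⟩⟩
  rw [rhoMin, hA.1.spectrum_real_eq_range_eigenvalues]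
  obtain ⟨i, hi⟩ := (Set.range_nonempty hA.1.eigenvalues).csInf_mem (Set.finite_range _)
  rw [← hi]
  exact hA.eigenvalues_pos i

theorem one_le_cond {K : ℕ} (hK : 0 < K) {A : Matrix (Fin K) (Fin K) ℝ} (hA : A.PosDef) :
    1 ≤ cond A := by
  have : Nonempty (Fin K) := ⟨⟨0, hK⟩⟩
  rw [cond, one_le_div (rhoMin_pos hK hA), rhoMin, rhoMax,
    hA.1.spectrum_real_eq_range_eigenvalues]
  exact csInf_le_csSup (Set.range_nonempty _) (Set.finite_range _).bddBelow
    (Set.finite_range _).bddAbove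

theorem sqrt_rhoMin_mul_norm_le {n K : ℕ} (H : Matrix (Fin n) (Fin K) ℝ)
    (x : EuclideanSpace ℝ (Fin K)) :
    √(rhoMin (Hᵀ * H)) * ‖x‖ ≤ ‖H.toEuclideanLin x‖ := by
  have hA : (Hᵀ * H).IsHermitian := by
    rw [← Matrix.conjTranspose_eq_transpose_of_trivial]
    exact Matrix.isHermitian_conjTranspose_mul_self H
  have hpsd : (Hᵀ * H - algebraMap ℝ _ (rhoMin (Hᵀ * H))).PosSemidef := by
    rw [Matrix.posSemidef_iff_isHermitian_and_spectrum_nonneg]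
    refine ⟨hA.sub (by simp [Matrix.IsHermitian, Matrix.algebraMap_eq_diagonal]), ?_⟩
    rw [← spectrum.sub_singleton_eq]
    rintro _ ⟨a, ha, _, rfl, rfl⟩
    refine sub_nonneg.2 (csInf_le ?_ ha)
    rw [hA.spectrum_real_eq_range_eigenvalues]
    exact (Set.finite_range _).bddBelow
  have h := hpsd.dotProduct_mulVec_nonneg x.ofLp
  rw [Matrix.sub_mulVec, Algebra.algebraMap_eq_smul_one, Matrix.smul_mulVec, Matrix.one_mulVec,
    star_trivial, dotProduct_sub, dotProduct_smul, dotProduct_comm,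
    ← inner_toEuclideanLin_toEuclideanLin, real_inner_self_eq_norm_sq] at h
  have h2 : inner ℝ x x = x.ofLp ⬝ᵥ x.ofLp := by
    rw [EuclideanSpace.inner_eq_star_dotProduct, star_trivial]
  rw [← h2, real_inner_self_eq_norm_sq, smul_eq_mul, sub_nonneg] at h
  rw [← Real.sqrt_sq (norm_nonneg x), ← Real.sqrt_mul' _ (sq_nonneg _)]
  exact Real.sqrt_le_iff.2 ⟨norm_nonneg _, h⟩

/-- The deterministic error bound: `s = nγ² / ρ_min` is the noise-to-signal ratio. -/
theorem norm_proj_sub_ridgeProj_sq_le {n K : ℕ} (hK : 0 < K) {H N : Matrix (Fin n) (Fin K) ℝ}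
    (hH : H.rank = K) {α C d s : ℝ} (hC : 0 < C) (hd : 0 < d) (hs : 0 ≤ s)
    (hα : α = 2 * d * (s * rhoMin (Hᵀ * H)))
    (hN : ‖N.toEuclideanLin.toContinuousLinearMap‖ ^ 2 ≤ C * (s * rhoMin (Hᵀ * H))) :
    ‖proj H - ridgeProj α (H + N)‖ ^ 2 ≤ (32 * C + 8 * d ^ 2 / C) * s := by
  set r := rhoMin (Hᵀ * H) with hr_def
  have hr : 0 < r := rhoMin_pos hK (posDef_transpose_mul_self hH)
  have hα0 : 0 ≤ α := by rw [hα]; positivity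
  set ε := ‖N.toEuclideanLin.toContinuousLinearMap‖ with hε
  have hε0 : 0 ≤ ε := norm_nonneg _
  have hNx : ∀ x, ‖N.toEuclideanLin x‖ ≤ ε * ‖x‖ :=
    fun x => N.toEuclideanLin.toContinuousLinearMap.le_opNorm x
  have hsqrt : 0 < √r := Real.sqrt_pos.2 hr
  have hsq : √r ^ 2 = r := Real.sq_sqrt hr.le
  have hTx : ∀ x, √r * ‖x‖ ≤ ‖H.toEuclideanLin x‖ := sqrt_rhoMin_mul_norm_le H
  -- The threshold is exactly what turns ε² ≤ C s r into ε ≤ √r / 2.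
  rcases le_or_gt (4 * C * s) 1 with hsmall | hlarge
  · have hεr : ε ≤ √r / 2 := by
      refine (sq_le_sq₀ hε0 (by positivity)).1 ?_
      rw [div_pow, hsq]
      nlinarith
    have hinj : Function.Injective (H + N).toEuclideanLin := by
      rw [injective_iff_map_eq_zero]
      intro x hx
      rw [map_add, LinearMap.add_apply, add_eq_zero_iff_eq_neg] at hx
      have h1 := hTx x
      rw [hx, norm_neg] at h1
      have h2 : √r * ‖x‖ ≤ √r / 2 * ‖x‖ := (h1.trans (hNx x)).trans (by gcongr)
      by_contra h0
      have := norm_pos_iff.2 h0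
      nlinarith [mul_pos hsqrt this]
    have hQ := ridgeProj_spec (H + N) (isUnit_det_gram_add_smul (H + N) hα0 (Or.inr hinj))
    rw [map_add] at hQ
    have h := norm_starProjection_sub_le (colSpan_eq_range H) hα0 hsqrt hTx hNx hε0 hεr hQ
    change ‖proj H - ridgeProj α (H + N)‖ ≤ _ at h
    have h1 : (4 * ε / √r) ^ 2 ≤ 16 * C * s := by
      rw [div_pow, hsq, div_le_iff₀ hr]
      linarith
    have h2 : 2 * α / √r ^ 2 = 4 * d * s := by
      rw [hsq, hα]
      field_simp
      ring
    rw [h2] at h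
    -- Small s makes the squared ridge bias, of order s², linear in s.
    have h3 : d ^ 2 * s ≤ d ^ 2 / (4 * C) := by
      rw [le_div_iff₀ (by positivity)]
      nlinarith [sq_nonneg d]
    calc _ ≤ (4 * ε / √r + 4 * d * s) ^ 2 := by gcongr
      _ ≤ 2 * ((4 * ε / √r) ^ 2 + (4 * d * s) ^ 2) := add_sq_le
      _ ≤ 2 * (16 * C * s + 16 * (d ^ 2 / (4 * C)) * s) := by
          gcongr
          calc (4 * d * s) ^ 2 = 16 * (d ^ 2 * s) * s := by ring
            _ ≤ _ := by gcongr
      _ = _ := by field_simp; ring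
  · have hs' : 0 < s := by
      by_contra! h0
      nlinarith
    have hα' : 0 < α := by rw [hα]; positivity
    have h := norm_starProjection_sub_le_two (colSpan H) hα0
      (ridgeProj_spec (H + N) (isUnit_det_gram_add_smul (H + N) hα0 (Or.inl hα')))
    change ‖proj H - ridgeProj α (H + N)‖ ≤ _ at h
    have h1 : 0 ≤ 8 * d ^ 2 / C * s := by positivity
    -- Here 2² < 16 C s ≤ 32 C s.
    nlinarith [norm_nonneg (proj H - ridgeProj α (H + N))]

end RidgeProj

theorem mainTheorem10 (δ : ℝ) (hδ0 : 0 < δ) (hδ1 : δ < 1) (d : ℝ) (hd : 0 < d) :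
    ∃ D : ℝ, 0 < D ∧
      ∀ (n K : ℕ) (_hK : 0 < K) (H : Matrix (Fin n) (Fin K) ℝ) (_hH : H.rank = K) (γ : ℝ)
        (Ω : Type*) [MeasurableSpace Ω] (P : Measure Ω) [IsProbabilityMeasure P]
        (E : Ω → Matrix (Fin n) (Fin K) ℝ) (_hE : RidgeProj.IsIIDGaussian γ E P) (α : ℝ)
        (_hα : α = 2 * d * γ ^ 2 * n),
        1 - δ ≤ P.real {ω |
          1 / (n : ℝ) * ‖RidgeProj.proj H - RidgeProj.ridgeProj α (H + E ω)‖ ^ 2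
            ≤ γ ^ 2 * D * (RidgeProj.cond (Hᵀ * H) ^ 3 * (1 / RidgeProj.rhoMin (Hᵀ * H)))} := by

  have hC := RidgeProj.noiseConst_pos hδ0 hδ1
  set C := RidgeProj.noiseConst δ with hC_def
  refine ⟨32 * C + 8 * d ^ 2 / C, by positivity, ?_⟩
  intro n K hK H hH γ Ω _ P _ E hE α hα
  -- Full rank forces K ≤ n, so both nets have at most 5ⁿ points.
  have hKn : K ≤ n := hH ▸ (H.rank_le_height)
  have hn : 0 < n := hK.trans_le hKn
  have hn' : (0 : ℝ) < n := by exact_mod_cast hn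
  have hA := RidgeProj.posDef_transpose_mul_self hH
  have hr := RidgeProj.rhoMin_pos hK hA
  have hcond := RidgeProj.one_le_cond hK hA
  refine (RidgeProj.one_sub_le_measureReal_opNorm_sq_le hδ0 hδ1 hn hKn hE).trans
    (measureReal_mono fun ω hω => ?_)
  rw [Set.mem_ofPred_eq] at hω ⊢
  set r := RidgeProj.rhoMin (Hᵀ * H) with hr_def
  have hs : n * γ ^ 2 / r * r = n * γ ^ 2 := div_mul_cancel₀ _ hr.ne'
  have h := RidgeProj.norm_proj_sub_ridgeProj_sq_le hK hH hC hd (s := n * γ ^ 2 / r)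
    (by positivity) (α := α) (by rw [hs, hα]; ring) (N := E ω) (by rwa [hs])
  calc _ ≤ 1 / (n : ℝ) * ((32 * C + 8 * d ^ 2 / C) * (n * γ ^ 2 / r)) := by gcongr
    _ = γ ^ 2 * (32 * C + 8 * d ^ 2 / C) * (1 * (1 / r)) := by field_simp
    _ ≤ _ := by
        gcongr
        exact one_le_pow₀ hcond
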